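/- Let $n>1$ be an odd integer and let $p_2,\dots,p_n:\mathbb{R}\to\mathbb{C}$ be $1$-periodic PT-symmetric functions ($\overline{p_v(-x)}=p_v(x)$ a.e.) with $(p_v)^{(n-v)}\in L_2[0,1]$, i.e. $p_v,\dots,(p_v)^{(n-v-1)}$ are locally absolutely continuous on $\mathbb{R}$ and $(p_v)^{(n-v)}\in L_2[0,1]$. For $t\in(-1,1]$ let $L_t$ be the operator generated in $L_2[0,1]$ by the expression $$l(y)=(-i)^n y^{(n)}+\sum_{v=2}^{n}(-i)^{n-v}p_v\,y^{(n-v)}$$ and the boundary conditions $y^{(\nu)}(1)=e^{i\pi t}y^{(\nu)}(0)$, $\nu=0,\dots,n-1$; let $L_t(0)$ be this operator for $p_2=\dots=p_n=0$, and put $L_{t,\varepsilon}=L_t(0)+\varepsilon(L_t-L_t(0))$ for $\varepsilon\in[0,1]$. Let $$C=\sum_{v=2}^{n}\sum_{s=0}^{n-v}\frac{(n-v)!\,\|(p_v)^{(s)}\|}{s!\,(n-v-s)!\,\pi^{v+s-2}},$$ where $\|\cdot\|$ is the norm of $L_2[0,1]$, and let $N$ be the least integer with $N\ge \pi^{-2}C+1$.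 For $k\in\mathbb{Z}$ put $$I(k,t)=[(2\pi k+\pi t-\pi)^n,(2\pi k+\pi t+\pi)^n),\qquad P(k,t)=\{\lambda\in\mathbb{C}:\operatorname{Re}\lambda\in I(k,t)\},$$ $$U(k,t)=\{\lambda\in\mathbb{C}:|\lambda-(2\pi k+\pi t)^n|<\tfrac32\pi^{n-2}C|2k+t|^{n-2}\},$$ $$S(N,t)=\{\lambda\in\mathbb{C}:\operatorname{Re}\lambda\in[(-2\pi N+\pi+\pi t)^n,(2\pi N-\pi+\pi t)^n)\}.$$ Then for every $t\in(-1,1]$ the following hold. (a) If $C>0$ (that is, the $p_v$ do not all vanish almost everywhere), then for every $k\in\mathbb{Z}$ with $|k|\ge N$ and every $\varepsilon\in[0,1]$, each eigenvalue of $L_{t,\varepsilon}$ lying in the strip $P(k,t)$ lies in the disk $U(k,t)$. (b) The closures of $S(N,t)$ and of the disks $U(k,t)$, $k\in\mathbb{Z}$, $|k|\ge N$, are pairwise disjoint (closed) sets. -/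

import Mathlib

open MeasureTheory Set

noncomputable section

namespace OddBloch

/-- Lebesgue measure on `[0,1]`. -/
abbrev unitMeasure : Measure ℝ := volume.restrict (Icc (0 : ℝ) 1)

/-- The norm of `L₂[0,1]`. -/
def l2norm (f : ℝ → ℂ) : ℝ := (eLpNorm f 2 unitMeasure).toReal

/-- `p` has `m` derivatives on `ℝ` in the sense that `p, p', …, p^(m-1)` exist and are locally
absolutely continuous, and the (almost everywhere defined) derivative `p^(m)` is in `L₂[0,1]`.
For `m = 0` this says that `p` is in `L₂[0,1]`. -/
def HasL2Deriv (m : ℕ) (p : ℝ → ℂ) : Prop :=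
  (∀ s < m, ContDiff ℝ s p ∧
    ∀ a b : ℝ, AbsolutelyContinuousOnInterval (iteratedDeriv s p) a b) ∧
  MemLp (iteratedDeriv m p) 2 unitMeasure

/-- PT-symmetry: `conj (p (-x)) = p x`. -/
def IsPTSymmetric (p : ℝ → ℂ) : Prop :=
  ∀ᵐ x : ℝ, (starRingEnd ℂ) (p (-x)) = p x

/-- Admissible coefficients `p₂, …, pₙ` (the values `p v` for other `v` play no role). -/
structure IsCoeff (n : ℕ) (p : ℕ → ℝ → ℂ) : Prop where
  periodic : ∀ v ∈ Finset.Icc 2 n, Function.Periodic (p v) 1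
  pt : ∀ v ∈ Finset.Icc 2 n, IsPTSymmetric (p v)
  deriv_mem : ∀ v ∈ Finset.Icc 2 n, HasL2Deriv (n - v) (p v)

/-- The `j`-th derivative of a function on `[0,1]` (one-sided at the endpoints). -/
def D (j : ℕ) (y : ℝ → ℂ) : ℝ → ℂ := iteratedDerivWithin j y (Icc (0 : ℝ) 1)

/-- The differential expression
`l(y) = (-i)ⁿ y⁽ⁿ⁾ + ∑_{v=2}^{n} (-i)^{n-v} p_v y^{(n-v)}` on `[0,1]`. -/
def expr (n : ℕ) (p : ℕ → ℝ → ℂ) (y : ℝ → ℂ) (x : ℝ) : ℂ :=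
  (-Complex.I) ^ n * D n y x +
    ∑ v ∈ Finset.Icc 2 n, (-Complex.I) ^ (n - v) * p v x * D (n - v) y x

/-- The domain of the operator `L_t` generated in `L₂[0,1]` by the expression with coefficients
`p` and the quasi-periodic boundary conditions `y^(ν)(1) = e^{iπt} y^(ν)(0)`, `ν < n`:
`y, …, y^(n-1)` are absolutely continuous on `[0,1]` and `l(y)` is in `L₂[0,1]`. -/
structure InDomain (n : ℕ) (p : ℕ → ℝ → ℂ) (t : ℝ) (y : ℝ → ℂ) : Prop where
  contDiffOn : ∀ j < n, ContDiffOn ℝ j y (Icc (0 : ℝ) 1)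
  absCont : ∀ j < n, AbsolutelyContinuousOnInterval (D j y) 0 1
  memLp : MemLp (expr n p y) 2 unitMeasure
  boundary : ∀ j < n, D j y 1 = Complex.exp (Complex.I * Real.pi * t) * D j y 0

/-- `lam` is an eigenvalue of `L_{t,ε} = L_t(0) + ε (L_t - L_t(0))`, where `L_t(0)` is the operator
with zero coefficients: some nonzero `y` in the domain of `L_t(0) + ε (L_t - L_t(0))`
satisfies `L_{t,ε} y = lam y` in `L₂[0,1]`. -/
def IsEigenvalue (n : ℕ) (p : ℕ → ℝ → ℂ) (t ε : ℝ) (lam : ℂ) : Prop :=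
  ∃ y : ℝ → ℂ, InDomain n 0 t y ∧ InDomain n p t y ∧ ¬ (y =ᵐ[unitMeasure] 0) ∧
    ∀ᵐ x ∂unitMeasure,
      expr n 0 y x + (ε : ℂ) * (expr n p y x - expr n 0 y x) = lam * y x

/-- The constant `C`. -/
def constC (n : ℕ) (p : ℕ → ℝ → ℂ) : ℝ :=
  ∑ v ∈ Finset.Icc 2 n, ∑ s ∈ Finset.range (n - v + 1),
    ((n - v).factorial : ℝ) * l2norm (iteratedDeriv s (p v)) /
      ((s.factorial : ℝ) * ((n - v - s).factorial : ℝ) * Real.pi ^ (v + s - 2))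

/-- The interval `I(k,t) = [(2πk+πt-π)ⁿ, (2πk+πt+π)ⁿ)`. -/
def intervalI (n : ℕ) (k : ℤ) (t : ℝ) : Set ℝ :=
  Ico ((2 * Real.pi * k + Real.pi * t - Real.pi) ^ n)
    ((2 * Real.pi * k + Real.pi * t + Real.pi) ^ n)

/-- The strip `P(k,t) = {λ : Re λ ∈ I(k,t)}`. -/
def stripP (n : ℕ) (k : ℤ) (t : ℝ) : Set ℂ := {z | z.re ∈ intervalI n k t}

/-- The strip `S(N,t) = {λ : Re λ ∈ [(-2πN+π+πt)ⁿ, (2πN-π+πt)ⁿ)}`. -/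
def stripS (n : ℕ) (N : ℤ) (t : ℝ) : Set ℂ :=
  {z | z.re ∈ Ico ((-2 * Real.pi * N + Real.pi + Real.pi * t) ^ n)
    ((2 * Real.pi * N - Real.pi + Real.pi * t) ^ n)}

/-- The open disk `U(k,t)` about `(2πk+πt)ⁿ` with radius `(3/2) π^{n-2} C |2k+t|^{n-2}`. -/
def diskU (n : ℕ) (p : ℕ → ℝ → ℂ) (k : ℤ) (t : ℝ) : Set ℂ :=
  Metric.ball ((((2 * Real.pi * k + Real.pi * t) ^ n : ℝ)) : ℂ)
    (3 / 2 * Real.pi ^ (n - 2) * constC n p * |2 * (k : ℝ) + t| ^ (n - 2))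

end OddBloch

end

noncomputable section

namespace OddBloch

/-! Let `y` be an eigenfunction for `lam`, and let `Y_m` be its Fourier coefficient against
`e^{iπ(2m+t)x}`. These exponentials are the eigenfunctions of the unperturbed operator. Testing the
equation against them and moving all derivatives off `y` gives `|lam - (π(2m+t))^n| |Y_m| ≤ π^{n-2}
C max(1,|2m+t|)^{n-2} ‖y‖` (`norm_sub_mul_norm_integral_le`).

Suppose `lam` lies in the strip `P(k,t)` but outside the disk `U(k,t)`. The factor 3/2 in the radius
forces `|Y_k| ≤ (2/3)‖y‖`. For `m ≠ k`, the real part of `lam` alone keeps it away from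
`(π(2m+t))^n`. Since `C ≤ π²(|k|-1)`, this yields `|Y_m|² ≤ coeffBound (±(m-k)) ‖y‖²`
(`exists_coeff_le_abs`). These bounds sum to less than 1 (`exists_hasSum_coeffBound`), contradicting
Parseval's identity (`hasSum_sq_integral_wave`).

For disjointness it is enough to project to the real axis: the radius of `U(k,t)` is smaller than
the distance from its centre to either end of `I(k,t)` (`radius_lt_gap`), and `x ↦ x^n` is strictly
increasing for odd `n`. -/

/-! ### Calculus of complex-valued absolutely continuous functions, through real and imaginary
parts. -/

theorem ac_comp_le {f : ℝ → ℂ} {g : ℝ → ℝ} {a b : ℝ} (hf : AbsolutelyContinuousOnInterval f a b)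
    (h : ∀ x y, dist (g x) (g y) ≤ dist (f x) (f y)) : AbsolutelyContinuousOnInterval g a b := by
  rw [absolutelyContinuousOnInterval_iff] at hf ⊢
  intro ε hε
  obtain ⟨δ, hδ, H⟩ := hf ε hε
  exact ⟨δ, hδ, fun E hE hs =>
    (Finset.sum_le_sum fun i _ => h _ _).trans_lt (H E hE hs)⟩

theorem ac_re {f : ℝ → ℂ} {a b : ℝ} (hf : AbsolutelyContinuousOnInterval f a b) :
    AbsolutelyContinuousOnInterval (fun x => (f x).re) a b :=
  ac_comp_le hf fun x y => by
    rw [Real.dist_eq, Complex.dist_eq, ← Complex.sub_re]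
    exact Complex.abs_re_le_norm _

theorem ac_im {f : ℝ → ℂ} {a b : ℝ} (hf : AbsolutelyContinuousOnInterval f a b) :
    AbsolutelyContinuousOnInterval (fun x => (f x).im) a b :=
  ac_comp_le hf fun x y => by
    rw [Real.dist_eq, Complex.dist_eq, ← Complex.sub_im]
    exact Complex.abs_im_le_norm _

theorem intervalIntegrable_ofReal {f : ℝ → ℝ} {a b : ℝ} (h : IntervalIntegrable f volume a b) :
    IntervalIntegrable (fun x => (f x : ℂ)) volume a b :=
  ⟨h.1.ofReal, h.2.ofReal⟩

/-- The derivative of a complex-valued absolutely continuous function exists almost everywhere. -/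
theorem ac_ae_hasDerivAt {f : ℝ → ℂ} {a b : ℝ} (hf : AbsolutelyContinuousOnInterval f a b) :
    ∀ᵐ x : ℝ, x ∈ uIcc a b → HasDerivAt f
      (((deriv (fun x => (f x).re) x : ℝ) : ℂ) + ((deriv (fun x => (f x).im) x : ℝ) : ℂ) * Complex.I) x := by
  filter_upwards [(ac_re hf).ae_differentiableAt, (ac_im hf).ae_differentiableAt] with x h1 h2 hx
  have h := (h1 hx).hasDerivAt.ofReal_comp.add ((h2 hx).hasDerivAt.ofReal_comp.mul_const Complex.I)
  refine h.congr_of_eventuallyEq (Filter.Eventually.of_forall fun y => ?_)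
  simp [Complex.re_add_im]

theorem ac_ae_deriv {f : ℝ → ℂ} {a b : ℝ} (hf : AbsolutelyContinuousOnInterval f a b) :
    ∀ᵐ x : ℝ, x ∈ uIcc a b → HasDerivAt f (deriv f x) x := by
  filter_upwards [ac_ae_hasDerivAt hf] with x h hx
  exact (h hx).differentiableAt.hasDerivAt

theorem ac_intervalIntegrable_deriv {f : ℝ → ℂ} {a b : ℝ}
    (hf : AbsolutelyContinuousOnInterval f a b) :
    IntervalIntegrable (deriv f) volume a b := by
  have h := (intervalIntegrable_ofReal (ac_re hf).intervalIntegrable_deriv).add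
    ((intervalIntegrable_ofReal (ac_im hf).intervalIntegrable_deriv).mul_const Complex.I)
  refine h.congr_ae ?_
  rw [Filter.EventuallyEq, ae_restrict_iff' measurableSet_uIoc]
  filter_upwards [ac_ae_hasDerivAt hf] with x h hx
  exact (h (uIoc_subset_uIcc hx)).deriv.symm

theorem ac_integral_deriv {f : ℝ → ℂ} {a b : ℝ} (hf : AbsolutelyContinuousOnInterval f a b) :
    ∫ x in a..b, deriv f x = f b - f a := by
  have h1 : ∫ x in a..b, deriv f x = ∫ x in a..b,
      (((deriv (fun x => (f x).re) x : ℝ) : ℂ) + ((deriv (fun x => (f x).im) x : ℝ) : ℂ) * Complex.I) := by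
    apply intervalIntegral.integral_congr_ae
    filter_upwards [ac_ae_hasDerivAt hf] with x h hx
    exact (h (uIoc_subset_uIcc hx)).deriv
  rw [h1, intervalIntegral.integral_add
    (intervalIntegrable_ofReal (ac_re hf).intervalIntegrable_deriv)
    ((intervalIntegrable_ofReal (ac_im hf).intervalIntegrable_deriv).mul_const Complex.I),
    intervalIntegral.integral_mul_const, intervalIntegral.integral_ofReal,
    intervalIntegral.integral_ofReal, (ac_re hf).integral_deriv_eq_sub,
    (ac_im hf).integral_deriv_eq_sub]
  apply Complex.ext <;> simp

/-! ### Exponentials: integration by parts and Parseval's identity. -/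

/-- The conjugate exponential `e^{-iμx}`. -/
def wave (μ : ℝ) (x : ℝ) : ℂ := Complex.exp (-(Complex.I * μ * x))

theorem norm_wave (μ x : ℝ) : ‖wave μ x‖ = 1 := by
  rw [wave, show -(Complex.I * μ * x) = ((-(μ * x) : ℝ) : ℂ) * Complex.I by push_cast; ring,
    Complex.norm_exp_ofReal_mul_I]

theorem hasDerivAt_wave (μ x : ℝ) : HasDerivAt (wave μ) (-(Complex.I * μ) * wave μ x) x := by
  have h : HasDerivAt (fun x : ℝ => -(Complex.I * μ * (x : ℂ))) (-(Complex.I * μ)) x := by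
    have := ((hasDerivAt_id x).ofReal_comp.const_mul (Complex.I * μ)).neg
    simp only [Complex.ofReal_one, mul_one] at this
    exact this
  rw [mul_comm]
  exact h.cexp

theorem contDiff_wave (μ : ℝ) : ContDiff ℝ 1 (wave μ) := by
  unfold wave
  exact (contDiff_const.mul Complex.ofRealCLM.contDiff).neg.cexp

theorem continuous_wave (μ : ℝ) : Continuous (wave μ) := (contDiff_wave μ).continuous

theorem ac_wave (μ : ℝ) (a b : ℝ) : AbsolutelyContinuousOnInterval (wave μ) a b :=
  (contDiff_wave μ).contDiffOn.absolutelyContinuousOnInterval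

/-- Integration by parts against `e^{-iμx}` when the boundary terms cancel. -/
theorem integral_deriv_mul_wave {f f' g g' : ℝ → ℂ} {a b : ℝ} (μ : ℝ)
    (hf : AbsolutelyContinuousOnInterval f a b) (hg : AbsolutelyContinuousOnInterval g a b)
    (hf' : ∀ᵐ x : ℝ, x ∈ uIoc a b → f' x = deriv f x)
    (hg' : ∀ᵐ x : ℝ, x ∈ uIoc a b → g' x = deriv g x)
    (hbd : f b * g b * wave μ b = f a * g a * wave μ a) :
    ∫ x in a..b, f' x * g x * wave μ x =
      Complex.I * μ * (∫ x in a..b, f x * g x * wave μ x) -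
        ∫ x in a..b, f x * g' x * wave μ x := by
  have hw := ac_wave μ a b
  have hF : AbsolutelyContinuousOnInterval (fun x => f x * g x * wave μ x) a b :=
    (hf.fun_smul hg).fun_smul hw
  have i1 : IntervalIntegrable (fun x => f' x * g x * wave μ x) volume a b := by
    refine IntervalIntegrable.mul_continuousOn ?_ hw.continuousOn
    refine IntervalIntegrable.mul_continuousOn ?_ hg.continuousOn
    refine (ac_intervalIntegrable_deriv hf).congr_ae ?_
    rw [Filter.EventuallyEq, ae_restrict_iff' measurableSet_uIoc]
    filter_upwards [hf'] with x h hx using (h hx).symm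
  have i2 : IntervalIntegrable (fun x => f x * g' x * wave μ x) volume a b := by
    refine IntervalIntegrable.mul_continuousOn ?_ hw.continuousOn
    refine IntervalIntegrable.continuousOn_mul ?_ hf.continuousOn
    refine (ac_intervalIntegrable_deriv hg).congr_ae ?_
    rw [Filter.EventuallyEq, ae_restrict_iff' measurableSet_uIoc]
    filter_upwards [hg'] with x h hx using (h hx).symm
  have i3 : IntervalIntegrable (fun x => f x * g x * wave μ x) volume a b :=
    hF.continuousOn.intervalIntegrable
  have key : ∫ x in a..b, deriv (fun x => f x * g x * wave μ x) x =
      ∫ x in a..b, (f' x * g x * wave μ x + f x * g' x * wave μ x -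
        Complex.I * μ * (f x * g x * wave μ x)) := by
    apply intervalIntegral.integral_congr_ae
    filter_upwards [ac_ae_deriv hf, ac_ae_deriv hg, hf', hg'] with x h1 h2 h3 h4 hx
    have hx' := uIoc_subset_uIcc hx
    have h := ((h1 hx').mul (h2 hx')).mul (hasDerivAt_wave μ x)
    have := h.deriv
    simp only [Pi.mul_def] at this
    rw [this, h3 hx, h4 hx]
    ring
  rw [ac_integral_deriv hF, hbd, sub_self, intervalIntegral.integral_sub (i1.add i2)
    (i3.const_mul _), intervalIntegral.integral_add i1 i2,
    intervalIntegral.integral_const_mul] at key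
  linear_combination -key

/-- The Cauchy–Schwarz inequality in `L₂[0,1]`. -/
theorem norm_integral_mul_le_l2norm {f g w : ℝ → ℂ} (hf : MemLp f 2 unitMeasure)
    (hg : MemLp g 2 unitMeasure) (hw : ∀ x, ‖w x‖ = 1) :
    ‖∫ x in (0 : ℝ)..1, f x * g x * w x‖ ≤ l2norm f * l2norm g := by
  rw [intervalIntegral.integral_of_le zero_le_one, ← integral_Icc_eq_integral_Ioc]
  refine (norm_integral_le_integral_norm _).trans ?_
  simp only [norm_mul, hw, mul_one]
  have h := integral_mul_norm_le_Lp_mul_Lq (μ := unitMeasure) (f := f) (g := g) (p := 2) (q := 2)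
    Real.HolderConjugate.two_two (by simpa using hf) (by simpa using hg)
  refine h.trans (le_of_eq ?_)
  rw [l2norm, l2norm, hf.eLpNorm_eq_integral_rpow_norm (by norm_num) (by norm_num),
    hg.eLpNorm_eq_integral_rpow_norm (by norm_num) (by norm_num),
    ENNReal.toReal_ofReal (by positivity), ENNReal.toReal_ofReal (by positivity)]
  simp

theorem l2norm_sq {f : ℝ → ℂ} (hf : MemLp f 2 unitMeasure) :
    l2norm f ^ 2 = ∫ x in (0 : ℝ)..1, ‖f x‖ ^ 2 := by
  rw [l2norm, hf.eLpNorm_eq_integral_rpow_norm (by norm_num) (by norm_num),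
    ENNReal.toReal_ofReal (by positivity), intervalIntegral.integral_of_le zero_le_one,
    ← integral_Icc_eq_integral_Ioc, ← Real.rpow_natCast, ← Real.rpow_mul (by positivity)]
  simp

theorem l2norm_pos {f : ℝ → ℂ} (hf : MemLp f 2 unitMeasure) (h0 : ¬ f =ᵐ[unitMeasure] 0) :
    0 < l2norm f := by
  refine ENNReal.toReal_pos (fun h => h0 ?_) hf.eLpNorm_ne_top
  rwa [eLpNorm_eq_zero_iff hf.1 (by norm_num)] at h

/-- Parseval's identity for the orthonormal basis `e^{iπ(2m+t)x}`, `m ∈ ℤ`, of `L₂[0,1]`. -/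
theorem hasSum_sq_integral_wave {f : ℝ → ℂ} (hf : MemLp f 2 unitMeasure) (t : ℝ) :
    HasSum (fun m : ℤ => ‖∫ x in (0 : ℝ)..1, f x * wave (Real.pi * (2 * m + t)) x‖ ^ 2)
      (l2norm f ^ 2) := by
  -- The unimodular factor `e^{-iπtx}` reduces the shifted exponentials to the ordinary Fourier
  -- basis without changing the norm.
  have hg : MemLp (fun x => wave (Real.pi * t) x * f x) 2 (volume.restrict (Ioc (0 : ℝ) 1)) := by
    have hf' : MemLp f 2 (volume.restrict (Ioc (0 : ℝ) 1)) :=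
      hf.mono_measure (Measure.restrict_mono Ioc_subset_Icc_self le_rfl)
    refine hf'.of_le ((continuous_wave _).aestronglyMeasurable.mul hf'.1)
      (Filter.Eventually.of_forall fun x => ?_)
    simp [norm_wave]
  have h := hasSum_sq_fourierCoeffOn zero_lt_one hg
  convert h using 1
  · funext m
    rw [fourierCoeffOn_eq_integral]
    simp only [sub_zero, div_one, one_smul]
    congr 2
    apply intervalIntegral.integral_congr
    intro x _
    have : (fourier (-m) (x : AddCircle (1 - 0 : ℝ)) : ℂ) = wave (Real.pi * (2 * m)) x := by
      rw [fourier_coe_apply, wave]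
      congr 1
      push_cast
      ring
    simp only [smul_eq_mul]
    rw [this]
    simp only [wave]
    rw [mul_comm, ← mul_assoc, ← Complex.exp_add]
    congr 2
    push_cast
    ring
  · rw [l2norm_sq hf]
    simp [norm_wave]

/-! ### Fourier coefficients of eigenfunctions. -/

section Estimates

theorem D_succ_eq_deriv (j : ℕ) (y : ℝ → ℂ) {x : ℝ} (hx : x ∈ Ioo (0 : ℝ) 1) :
    D (j + 1) y x = deriv (D j y) x := by
  rw [D, iteratedDerivWithin_succ, derivWithin_of_mem_nhds (Icc_mem_nhds hx.1 hx.2)]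
  rfl

/-- Only almost everywhere: at the endpoint 1 the two-sided derivative depends on the values of `y`
outside `[0,1]`. -/
theorem ae_D_succ_eq_deriv (j : ℕ) (y : ℝ → ℂ) :
    ∀ᵐ x : ℝ, x ∈ uIoc (0 : ℝ) 1 → D (j + 1) y x = deriv (D j y) x := by
  have h1 : ∀ᵐ x : ℝ, x ≠ 1 := by simp [ae_iff]
  filter_upwards [h1] with x h1 hx
  rw [uIoc_of_le zero_le_one] at hx
  exact D_succ_eq_deriv j y ⟨hx.1, lt_of_le_of_ne hx.2 h1⟩

theorem D_zero (y : ℝ → ℂ) : D 0 y = y := by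
  unfold D
  exact iteratedDerivWithin_zero

theorem periodic_iteratedDeriv {q : ℝ → ℂ} (hq : Function.Periodic q 1) (s : ℕ) :
    Function.Periodic (iteratedDeriv s q) 1 := by
  intro x
  have h := congrFun (iteratedDeriv_comp_add_const s q 1) x
  rw [← h, show (fun z => q (z + 1)) = q from funext hq]

theorem memLp_of_continuousOn {f : ℝ → ℂ} (hf : ContinuousOn f (Icc (0 : ℝ) 1)) :
    MemLp f 2 unitMeasure := by
  obtain ⟨C, hC⟩ := isCompact_Icc.exists_bound_of_continuousOn hf
  refine MemLp.of_bound (hf.aestronglyMeasurable measurableSet_Icc) C ?_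
  exact (ae_restrict_iff' measurableSet_Icc).2 (Filter.Eventually.of_forall hC)

theorem HasL2Deriv.memLp {m : ℕ} {q : ℝ → ℂ} (hq : HasL2Deriv m q) {s : ℕ} (hs : s ≤ m) :
    MemLp (iteratedDeriv s q) 2 unitMeasure := by
  rcases hs.lt_or_eq with h | rfl
  · have := ((hq.1 s h).2 0 1).continuousOn
    rw [uIcc_of_le zero_le_one] at this
    exact memLp_of_continuousOn this
  · exact hq.2

theorem intervalIntegrable_of_memLp {f : ℝ → ℂ} (hf : MemLp f 2 unitMeasure) :
    IntervalIntegrable f volume 0 1 := by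
  rw [intervalIntegrable_iff_integrableOn_Icc_of_le zero_le_one]
  exact hf.integrable (by norm_num)

variable {n : ℕ} {t : ℝ} {y : ℝ → ℂ} {p : ℕ → ℝ → ℂ}

/-- The exponentials `e^{iπ(2k+t)x}` satisfy the same boundary conditions as the domain of `L_t`. -/
theorem InDomain.boundary_wave (hy : InDomain n p t y) {j : ℕ} (hj : j < n) (k : ℤ) :
    D j y 1 * wave (Real.pi * (2 * k + t)) 1 = D j y 0 * wave (Real.pi * (2 * k + t)) 0 := by
  rw [hy.boundary j hj]
  have : Complex.exp (Complex.I * Real.pi * t) * wave (Real.pi * (2 * k + t)) 1 = 1 := by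
    rw [wave, ← Complex.exp_add, Complex.exp_eq_one_iff]
    refine ⟨-k, ?_⟩
    push_cast
    ring
  have h0 : wave (Real.pi * (2 * k + t)) 0 = 1 := by simp [wave]
  rw [h0, mul_right_comm, this]
  ring

theorem InDomain.integral_D_mul_wave (hy : InDomain n p t y) (k : ℤ) {j : ℕ} (hj : j ≤ n) :
    ∫ x in (0 : ℝ)..1, D j y x * wave (Real.pi * (2 * k + t)) x =
      (Complex.I * (Real.pi * (2 * k + t) : ℝ)) ^ j *
        ∫ x in (0 : ℝ)..1, y x * wave (Real.pi * (2 * k + t)) x := by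
  induction j with
  | zero => simp [D_zero]
  | succ j ih =>
    have h := integral_deriv_mul_wave (f' := D (j + 1) y) (g := fun _ => 1) (g' := fun _ => 0)
      (Real.pi * (2 * k + t)) (hy.absCont j hj)
      (contDiff_const.contDiffOn.absolutelyContinuousOnInterval)
      (ae_D_succ_eq_deriv j y) (by simp) (by simpa using hy.boundary_wave hj k)
    simp only [mul_one, mul_zero, zero_mul, intervalIntegral.integral_zero, sub_zero] at h
    rw [h, ih (by omega), pow_succ']
    ring

/-- Each integration by parts moves one derivative from `y` either to the exponential, giving a
factor `|π(2k+t)|`, or to `q`. The binomial coefficients count these choices, by Pascal's rule in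
the induction on `j`. The order `s` must stay general because it grows in the second case. -/
theorem InDomain.norm_integral_D_mul_iteratedDeriv_le (hy : InDomain n p t y) (k : ℤ) {m : ℕ}
    (hm : m < n) {q : ℝ → ℂ} (hq : HasL2Deriv m q) (hper : Function.Periodic q 1) {j : ℕ} :
    ∀ {s : ℕ}, j + s ≤ m →
      ‖∫ x in (0 : ℝ)..1, D j y x * iteratedDeriv s q x * wave (Real.pi * (2 * k + t)) x‖ ≤
        l2norm y * ∑ ij ∈ Finset.HasAntidiagonal.antidiagonal j, (j.choose ij.1 : ℝ) *
          (l2norm (iteratedDeriv (s + ij.1) q) * |Real.pi * (2 * k + t)| ^ ij.2) := by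
  have hmem : MemLp y 2 unitMeasure := by
    have := (hy.absCont 0 (by omega)).continuousOn
    rw [uIcc_of_le zero_le_one, D_zero] at this
    exact memLp_of_continuousOn this
  induction j with
  | zero =>
    intro s hs
    simpa [D_zero] using norm_integral_mul_le_l2norm hmem (hq.memLp (by omega))
      (norm_wave (Real.pi * (2 * k + t)))
  | succ j ih =>
    intro s hs
    have h := integral_deriv_mul_wave (f' := D (j + 1) y) (g := iteratedDeriv s q)
      (g' := iteratedDeriv (s + 1) q)
      (Real.pi * (2 * k + t)) (hy.absCont j (by omega)) ((hq.1 s (by omega)).2 0 1)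
      (ae_D_succ_eq_deriv j y) (by simp [iteratedDeriv_succ]) (by
        -- The boundary terms cancel because `q^(s)` is 1-periodic and `y^(j)` times the exponential
        -- agrees at 0 and 1.
        have h1 := periodic_iteratedDeriv hper s 0
        rw [zero_add] at h1
        rw [h1, mul_right_comm, hy.boundary_wave (by omega) k, mul_right_comm])
    rw [h, Finset.sum_antidiagonal_choose_succ_mul (fun a b =>
      l2norm (iteratedDeriv (s + a) q) * |Real.pi * (2 * k + t)| ^ b), mul_add (l2norm y)]
    refine (norm_sub_le _ _).trans (add_le_add ?_ ?_)
    · have e : ‖Complex.I * ((Real.pi * (2 * k + t) : ℝ) : ℂ)‖ = |Real.pi * (2 * k + t)| := by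
        rw [norm_mul, Complex.norm_I, one_mul, Complex.norm_real, Real.norm_eq_abs]
      rw [norm_mul, e]
      refine (mul_le_mul_of_nonneg_left (ih (by omega)) (abs_nonneg _)).trans (le_of_eq ?_)
      rw [mul_left_comm, Finset.mul_sum]
      congr 1
      refine Finset.sum_congr rfl fun ij _ => ?_
      rw [pow_succ]
      ring
    · refine (ih (s := s + 1) (by omega)).trans (le_of_eq ?_)
      congr 1
      refine Finset.sum_congr rfl fun ij hij => ?_
      rw [Nat.choose_symm_of_eq_add (Finset.HasAntidiagonal.mem_antidiagonal.1 hij).symm, add_assoc s 1,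
        add_comm 1 ij.1]

theorem constC_nonneg (n : ℕ) (p : ℕ → ℝ → ℂ) : 0 ≤ constC n p :=
  Finset.sum_nonneg fun v _ => Finset.sum_nonneg fun s _ => by
    have : 0 ≤ l2norm (iteratedDeriv s (p v)) := ENNReal.toReal_nonneg
    positivity

/-- The weights in `constC` come from here: `π^{n-2} / π^{v+s-2} = π^{n-v-s}`. The maximum with 1 is
needed because for `|a| < 1` the lower powers of `|a|` exceed `|a|^{n-2}`. -/
theorem sum_choose_le_constC (n : ℕ) (p : ℕ → ℝ → ℂ) (a : ℝ) :
    ∑ v ∈ Finset.Icc 2 n, ∑ ij ∈ Finset.HasAntidiagonal.antidiagonal (n - v), ((n - v).choose ij.1 : ℝ) *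
      (l2norm (iteratedDeriv ij.1 (p v)) * |Real.pi * a| ^ ij.2) ≤
    Real.pi ^ (n - 2) * constC n p * max 1 |a| ^ (n - 2) := by
  rw [constC, mul_right_comm, Finset.mul_sum]
  refine Finset.sum_le_sum fun v hv => ?_
  rw [Finset.mem_Icc] at hv
  rw [Finset.Nat.sum_antidiagonal_eq_sum_range_succ_mk, Finset.mul_sum]
  refine Finset.sum_le_sum fun s hs => ?_
  have hs' : s ≤ n - v := by simpa [Nat.lt_succ_iff] using hs
  have hl : 0 ≤ l2norm (iteratedDeriv s (p v)) := ENNReal.toReal_nonneg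
  have hM : (1 : ℝ) ≤ max 1 |a| := le_max_left _ _
  have h1 : |Real.pi * a| ^ (n - v - s) ≤ Real.pi ^ (n - v - s) * max 1 |a| ^ (n - 2) := by
    rw [abs_mul, abs_of_pos Real.pi_pos, mul_pow]
    refine mul_le_mul_of_nonneg_left ?_ (by positivity)
    exact (pow_le_pow_left₀ (abs_nonneg _) (le_max_right _ _) _).trans
      (pow_le_pow_right₀ hM (by omega))
  have h2 : Real.pi ^ (n - 2) = Real.pi ^ (n - v - s) * Real.pi ^ (v + s - 2) := by
    rw [← pow_add]
    congr 1
    omega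
  rw [Nat.cast_choose ℝ hs', h2]
  calc _ ≤ ((n - v).factorial : ℝ) / (s.factorial * (n - v - s).factorial) *
        (l2norm (iteratedDeriv s (p v)) *
          (Real.pi ^ (n - v - s) * max 1 |a| ^ (n - 2))) := by gcongr
    _ = _ := by
      have := Real.pi_pos
      field_simp

/-- The basic estimate of the Fourier coefficients of an eigenfunction. -/
theorem norm_sub_mul_norm_integral_le (hp : IsCoeff n p) (hn : 1 < n) {ε : ℝ}
    (hε : ε ∈ Icc (0 : ℝ) 1) {lam : ℂ} (hy : InDomain n p t y)
    (heq : ∀ᵐ x ∂unitMeasure,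
      expr n 0 y x + (ε : ℂ) * (expr n p y x - expr n 0 y x) = lam * y x) (k : ℤ) :
    ‖lam - ((Real.pi * (2 * k + t) : ℝ) : ℂ) ^ n‖ *
        ‖∫ x in (0 : ℝ)..1, y x * wave (Real.pi * (2 * k + t)) x‖ ≤
      Real.pi ^ (n - 2) * constC n p * max 1 |2 * (k : ℝ) + t| ^ (n - 2) * l2norm y := by
  set μ : ℝ := Real.pi * (2 * k + t) with hμ
  set Y : ℂ := ∫ x in (0 : ℝ)..1, y x * wave μ x with hY
  have hcont : ∀ j < n, ContinuousOn (D j y) (uIcc 0 1) := fun j hj => (hy.absCont j hj).continuousOn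
  have hw : ContinuousOn (wave μ) (uIcc 0 1) := (continuous_wave μ).continuousOn
  have itop : IntervalIntegrable (fun x => D n y x * wave μ x) volume 0 1 := by
    refine IntervalIntegrable.mul_continuousOn ?_ hw
    obtain ⟨j, rfl⟩ : ∃ j, n = j + 1 := ⟨n - 1, by omega⟩
    refine (ac_intervalIntegrable_deriv (hy.absCont j (by omega))).congr_ae ?_
    rw [Filter.EventuallyEq, ae_restrict_iff' measurableSet_uIoc]
    filter_upwards [ae_D_succ_eq_deriv j y] with x h hx using (h hx).symm
  have ilow : ∀ v ∈ Finset.Icc 2 n, IntervalIntegrable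
      (fun x => D (n - v) y x * p v x * wave μ x) volume 0 1 := fun v hv => by
    have hp0 := (hp.deriv_mem v hv).memLp (Nat.zero_le _)
    rw [iteratedDeriv_zero] at hp0
    rw [Finset.mem_Icc] at hv
    exact ((intervalIntegrable_of_memLp hp0).continuousOn_mul
      (hcont _ (by omega))).mul_continuousOn hw
  have isum : IntervalIntegrable (fun x => ∑ v ∈ Finset.Icc 2 n,
      (-Complex.I) ^ (n - v) * (D (n - v) y x * p v x * wave μ x)) volume 0 1 := by
    have := IntervalIntegrable.sum (Finset.Icc 2 n)
      (f := fun v x => (-Complex.I) ^ (n - v) * (D (n - v) y x * p v x * wave μ x))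
      fun v hv => (ilow v hv).const_mul _
    refine this.congr fun x _ => ?_
    simp only [Finset.sum_apply]
  have main : (-Complex.I) ^ n * (∫ x in (0 : ℝ)..1, D n y x * wave μ x) +
      ε * ∑ v ∈ Finset.Icc 2 n, (-Complex.I) ^ (n - v) *
        ∫ x in (0 : ℝ)..1, D (n - v) y x * p v x * wave μ x = lam * Y := by
    have h1 : ∫ x in (0 : ℝ)..1, lam * (y x * wave μ x) = ∫ x in (0 : ℝ)..1,
        ((-Complex.I) ^ n * (D n y x * wave μ x) + ε * ∑ v ∈ Finset.Icc 2 n,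
          (-Complex.I) ^ (n - v) * (D (n - v) y x * p v x * wave μ x)) := by
      apply intervalIntegral.integral_congr_ae
      rw [ae_restrict_iff' measurableSet_Icc] at heq
      filter_upwards [heq] with x h hx
      rw [uIoc_of_le zero_le_one] at hx
      rw [← mul_assoc, ← h (Ioc_subset_Icc_self hx)]
      simp only [expr, Pi.zero_apply, mul_zero, zero_mul, Finset.sum_const_zero, add_zero,
        add_sub_cancel_left, add_mul, Finset.sum_mul, Finset.mul_sum]
      congr 1
      · ring
      · refine Finset.sum_congr rfl fun v _ => ?_
        ring
    rw [intervalIntegral.integral_const_mul] at h1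
    rw [hY, h1, intervalIntegral.integral_add (itop.const_mul _),
      intervalIntegral.integral_const_mul, intervalIntegral.integral_const_mul,
      intervalIntegral.integral_finsetSum]
    · simp only [intervalIntegral.integral_const_mul]
    · exact fun v hv => (ilow v hv).const_mul _
    · exact isum.const_mul _
  -- The leading term has symbol `(-i)^n (iμ)^n = μ^n`.
  rw [hy.integral_D_mul_wave k le_rfl, ← hμ, ← hY, ← mul_assoc, ← mul_pow,
    show -Complex.I * (Complex.I * (μ : ℂ)) = μ by
      rw [← mul_assoc, neg_mul, Complex.I_mul_I]; ring] at main
  have main' : (lam - (μ : ℂ) ^ n) * Y = ε * ∑ v ∈ Finset.Icc 2 n, (-Complex.I) ^ (n - v) *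
        ∫ x in (0 : ℝ)..1, D (n - v) y x * p v x * wave μ x := by
    linear_combination -main
  rw [← norm_mul, main', norm_mul]
  have hεn : ‖(ε : ℂ)‖ ≤ 1 := by
    rw [Complex.norm_real, Real.norm_eq_abs, abs_of_nonneg hε.1]
    exact hε.2
  refine (mul_le_of_le_one_left (norm_nonneg _) hεn).trans ?_
  refine (norm_sum_le _ _).trans ?_
  rw [mul_comm _ (l2norm y)]
  refine le_trans ?_ (mul_le_mul_of_nonneg_left (sum_choose_le_constC n p (2 * k + t))
    ENNReal.toReal_nonneg)
  rw [Finset.mul_sum]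
  refine Finset.sum_le_sum fun v hv => ?_
  have hv' := Finset.mem_Icc.1 hv
  rw [norm_mul, norm_pow, norm_neg, Complex.norm_I, one_pow, one_mul]
  simpa [hμ] using hy.norm_integral_D_mul_iteratedDeriv_le k (m := n - v) (by omega)
    (hp.deriv_mem v hv) (hp.periodic v hv) (j := n - v) (s := 0) le_rfl

end Estimates

/-! ### Numerical weights with sum less than 1. -/

/-- Upper bounds of the squared Fourier coefficients of a normalized eigenfunction, indexed by the
signed distance from the strip of the eigenvalue. -/
def coeffBound : ℤ → ℝ
  | Int.ofNat 0 => 4 / 9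
  | Int.ofNat 1 => 1 / 16
  | Int.ofNat (m + 2) => 1 / 64 * (1 / (((m : ℝ) + 1) * (m + 2)))
  | Int.negSucc 0 => 1 / 4
  | Int.negSucc 1 => 1 / 36
  | Int.negSucc (m + 2) => 1 / 4 * (1 / (((m : ℝ) + 2) * (m + 3)))

/-- Telescoping: each term is `1/(m+c) - 1/(m+c+1)`. -/
theorem hasSum_one_div_mul (c : ℝ) (hc : 0 < c) :
    HasSum (fun m : ℕ => 1 / (((m : ℝ) + c) * (m + (c + 1)))) (1 / c) := by
  rw [hasSum_iff_tendsto_nat_of_nonneg fun m => by positivity]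
  have h : ∀ k : ℕ, ∑ m ∈ Finset.range k, 1 / (((m : ℝ) + c) * (m + (c + 1))) =
      1 / c - 1 / ((k : ℝ) + c) := by
    intro k
    induction k with
    | zero => simp
    | succ k ih =>
      rw [Finset.sum_range_succ, ih]
      push_cast
      field_simp
      ring
  simp only [h]
  have h1 : Filter.Tendsto (fun k : ℕ => 1 / ((k : ℝ) + c)) Filter.atTop (nhds 0) := by
    simp only [one_div]
    exact (Filter.tendsto_atTop_add_const_right _ c tendsto_natCast_atTop_atTop).inv_tendsto_atTop
  simpa using tendsto_const_nhds.sub h1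

/-- The total is 533/576: the central term 4/9, the right side 1/16 + 1/64, and the left side 1/4 +
1/36 + 1/8. -/
theorem exists_hasSum_coeffBound : ∃ T < 1, HasSum coeffBound T := by
  have h1 : HasSum (fun m : ℕ => coeffBound m) (1 / 64 * (1 / 1) + (4 / 9 + 1 / 16)) := by
    have h := (hasSum_one_div_mul 1 one_pos).mul_left (1 / 64)
    have e : (4 / 9 + 1 / 16 : ℝ) = ∑ i ∈ Finset.range 2, coeffBound (i : ℕ) := by
      simp only [Finset.sum_range_succ, Finset.sum_range_zero, zero_add]
      rfl
    rw [e]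
    refine (hasSum_nat_add_iff (f := fun m : ℕ => coeffBound m) 2).1 ?_
    refine (congrArg (HasSum · _) (funext fun m => ?_)).mp h
    change _ = 1 / 64 * (1 / (((m : ℝ) + 1) * (m + 2)))
    norm_num
  have h2 : HasSum (fun m : ℕ => coeffBound (-(m + 1 : ℤ)))
      (1 / 4 * (1 / 2) + (1 / 4 + 1 / 36)) := by
    have e' : (fun m : ℕ => coeffBound (-(m + 1 : ℤ))) = fun m : ℕ => coeffBound (Int.negSucc m) := by
      funext m
      rw [Int.negSucc_eq]
    have h := (hasSum_one_div_mul 2 two_pos).mul_left (1 / 4)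
    have e : (1 / 4 + 1 / 36 : ℝ) = ∑ i ∈ Finset.range 2, coeffBound (Int.negSucc i) := by
      simp only [Finset.sum_range_succ, Finset.sum_range_zero, zero_add]
      rfl
    rw [e, e']
    refine (hasSum_nat_add_iff (f := fun m : ℕ => coeffBound (Int.negSucc m)) 2).1 ?_
    refine (congrArg (HasSum · _) (funext fun m => ?_)).mp h
    change _ = 1 / 4 * (1 / (((m : ℝ) + 2) * (m + 3)))
    norm_num
  exact ⟨_, by norm_num, h1.of_nat_of_neg_add_one h2⟩

/-! ### Separation of odd powers, rescaled by `π^n`, with `n = r + 2`. -/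

theorem sq_sub_sq_mul_pow_le {b c : ℝ} (hc : 0 ≤ c) (hcb : c ≤ b) (r : ℕ) :
    (b - c) * (b + c) * b ^ r ≤ b ^ (r + 2) - c ^ (r + 2) := by
  have h := mul_le_mul_of_nonneg_left (pow_le_pow_left₀ hc hcb r) (sq_nonneg c)
  nlinarith [pow_add b r 2, pow_add c r 2]

/-- Separation of `bⁿ` from the interval `[(a-1)ⁿ, (a+1)ⁿ]` for `b` to the right. -/
theorem sub_one_mul_pow_le_right {r : ℕ} {K a x J : ℝ} (hK : 2 ≤ K) (ha : 2 * K - 1 ≤ a)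
    (hJ : 1 ≤ J) (hx : x ≤ (a + 1) ^ (r + 2)) :
    (K - 1) * max 1 |a + 1 + J| ^ r ≤ 1 / (4 * J) * |x - (a + 1 + J) ^ (r + 2)| := by
  set c := a + 1 with hc
  have hb : max 1 |c + J| = c + J := by
    rw [abs_of_nonneg (by linarith), max_eq_right (by linarith)]
  rw [hb, abs_sub_comm]
  have h1 := sq_sub_sq_mul_pow_le (b := c + J) (c := c) (by linarith) (by linarith) r
  have h2 : (c + J - c) * (c + J + c) * (c + J) ^ r ≤ |(c + J) ^ (r + 2) - x| :=
    (h1.trans (by linarith)).trans (le_abs_self _)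
  have hp : 0 < (c + J) ^ r := pow_pos (by linarith) r
  rw [div_mul_eq_mul_div, one_mul, le_div_iff₀ (by linarith)]
  refine le_trans ?_ h2
  -- The constant 4 comes from `2c ≥ 4K`.
  have h3 : (K - 1) * (4 * J) ≤ (c + J - c) * (c + J + c) := by nlinarith
  nlinarith [mul_le_mul_of_nonneg_right h3 hp.le]

/-- With `c = a - 1` and `J ≤ c`, one has `c^{r+2} - (c-J)^{r+2} ≥ c^r J(2c-J) ≥ J c^{r+1}`, while
`K - 1 ≤ c/2`. -/
theorem sub_one_mul_pow_le_left {r : ℕ} {K a x J : ℝ} (hK : 2 ≤ K) (ha : 2 * K - 1 ≤ a)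
    (hJ : 1 ≤ J) (hx : (a - 1) ^ (r + 2) ≤ x) (hb : 0 ≤ a - 1 - J) :
    (K - 1) * max 1 |a - 1 - J| ^ r ≤ 1 / (2 * J) * |x - (a - 1 - J) ^ (r + 2)| := by
  set c := a - 1 with hc
  rw [abs_of_nonneg hb]
  have hM : max 1 (c - J) ^ r ≤ c ^ r :=
    pow_le_pow_left₀ (by positivity) (max_le (by linarith) (by linarith)) r
  have h0 : (c - J) ^ r ≤ c ^ r := pow_le_pow_left₀ hb (by linarith) r
  have h1 : J * c * c ^ r ≤ |x - (c - J) ^ (r + 2)| := by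
    refine le_trans ?_ ((sub_le_sub_right hx _).trans (le_abs_self _))
    have h2 := mul_le_mul_of_nonneg_left h0 (sq_nonneg (c - J))
    have h3 : 0 ≤ J * (c - J) * c ^ r :=
      mul_nonneg (mul_nonneg (by linarith) hb) (pow_nonneg (by linarith) r)
    nlinarith [pow_add c r 2, pow_add (c - J) r 2]
  rw [div_mul_eq_mul_div, one_mul, le_div_iff₀ (by linarith)]
  refine le_trans ?_ h1
  have hp : 0 ≤ c ^ r := pow_nonneg (by linarith) r
  calc (K - 1) * max 1 (c - J) ^ r * (2 * J) ≤ (K - 1) * c ^ r * (2 * J) := by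
        have : 0 ≤ K - 1 := by linarith
        gcongr
    _ = (2 * (K - 1)) * J * c ^ r := by ring
    _ ≤ c * J * c ^ r := by gcongr; linarith
    _ = _ := by ring

/-- Past the origin the two powers add: with `c = a - 1` and `d = J - c`, oddness bounds the
distance below by `c^{r+2} + d^{r+2}`. If `M` is the larger of `c` and `d`, then `K - 1 ≤ M/2` and
`J = c + d ≤ 2M`, so a single power `M^{r+2}` suffices. -/
theorem sub_one_mul_pow_le_neg {r : ℕ} (hr : Odd r) {K a x J : ℝ} (hK : 2 ≤ K)
    (ha : 2 * K - 1 ≤ a) (hx : (a - 1) ^ (r + 2) ≤ x) (hb : a - 1 - J ≤ 0) :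
    (K - 1) * max 1 |a - 1 - J| ^ r ≤ 1 / J * |x - (a - 1 - J) ^ (r + 2)| := by
  set c := a - 1 with hc
  obtain ⟨d, hd⟩ : ∃ d, d = J - c := ⟨_, rfl⟩
  have hJ : J = c + d := by linarith
  have hd0 : 0 ≤ d := by linarith
  have hodd : Odd (r + 2) := hr.add_even even_two
  rw [show c - J = -d by linarith, abs_neg, abs_of_nonneg hd0, hodd.neg_pow, sub_neg_eq_add, hJ]
  refine le_trans ?_ (mul_le_mul_of_nonneg_left ((add_le_add_left hx _).trans (le_abs_self _))
    (one_div_nonneg.2 (by linarith)))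
  rw [div_mul_eq_mul_div, one_mul, le_div_iff₀ (by linarith)]
  have hc0 : 0 ≤ c / 2 := by linarith
  have hcd : 0 ≤ c + d := by linarith
  have hKc : K - 1 ≤ c / 2 := by linarith
  rcases le_total d c with h | h
  · have hM : max 1 d ^ r ≤ c ^ r :=
      pow_le_pow_left₀ (by positivity) (max_le (by linarith) h) r
    have hp : 0 ≤ c ^ r := pow_nonneg (by linarith) r
    calc (K - 1) * max 1 d ^ r * (c + d) ≤ (c / 2) * c ^ r * (c + c) := by
          gcongr
      _ = c ^ (r + 2) := by ring
      _ ≤ _ := by linarith [pow_nonneg hd0 (r + 2)]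
  · have hM : max 1 d = d := max_eq_right (by linarith)
    rw [hM]
    have hp : 0 ≤ d ^ r := pow_nonneg (by linarith) r
    have hKd : K - 1 ≤ d / 2 := by linarith
    calc (K - 1) * d ^ r * (c + d) ≤ (d / 2) * d ^ r * (d + d) := by
          gcongr
      _ = d ^ (r + 2) := by ring
      _ ≤ _ := by linarith [pow_nonneg (show 0 ≤ c by linarith) (r + 2)]

/-- The case `J = 3` needs the constant 1/6 on both sides of the origin: the general 1/3 would
replace 1/36 by 1/9 and push the sum of the weights above 1. -/
theorem sub_one_mul_pow_le_three {r : ℕ} (hr : Odd r) {K a x : ℝ} (hK : 2 ≤ K)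
    (ha : 2 * K - 1 ≤ a) (hx : (a - 1) ^ (r + 2) ≤ x) :
    (K - 1) * max 1 |a - 1 - 3| ^ r ≤ 1 / 6 * |x - (a - 1 - 3) ^ (r + 2)| := by
  rcases le_total 0 (a - 1 - 3) with hb | hb
  · have := sub_one_mul_pow_le_left hK ha (by norm_num : (1 : ℝ) ≤ 3) hx hb
    norm_num at this ⊢
    exact this
  -- Here `2 ≤ c ≤ 3`, so the maximum is 1, and `c^{r+2} ≥ c^3 ≥ 3c ≥ 6(K-1)`.
  · set c := a - 1 with hc
    have hodd : Odd (r + 2) := hr.add_even even_two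
    have hM : max 1 |c - 3| = 1 := by
      rw [abs_of_nonpos hb, max_eq_left (by linarith)]
    rw [hM, one_pow, mul_one]
    have h1 : (c - 3) ^ (r + 2) ≤ 0 := hodd.pow_nonpos hb
    have h2 : c ^ 3 ≤ c ^ (r + 2) := pow_le_pow_right₀ (by linarith) (by have := hr.pos; omega)
    have h3 := le_abs_self (x - (c - 3) ^ (r + 2))
    have h4 : 3 * c ≤ c ^ 3 := by nlinarith [mul_self_nonneg (c - 2)]
    linarith

/-- The point `a + 2j` lies at distance `J = 2|j| - 1` from the nearer of `a - 1` and `a + 1`. The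
weight `w` is `1/(4J)` to the right. To the left it is `1/(2J)` for `J = 1, 3` and `1/J` beyond. -/
theorem exists_coeff_le {r : ℕ} (hr : Odd r) {K a x : ℝ} (hK : 2 ≤ K)
    (ha : 2 * K - 1 ≤ a) (hx : x ∈ Icc ((a - 1) ^ (r + 2)) ((a + 1) ^ (r + 2)))
    {j : ℤ} (hj : j ≠ 0) :
    ∃ w : ℝ, 0 ≤ w ∧ w ^ 2 ≤ coeffBound j ∧
      (K - 1) * max 1 |a + 2 * j| ^ r ≤ w * |x - (a + 2 * j) ^ (r + 2)| := by
  rcases j with (_ | _ | m) | (_ | _ | m)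
  · exact absurd rfl hj
  · refine ⟨1 / (4 * 1), by norm_num, by norm_num [coeffBound], ?_⟩
    rw [show a + 2 * ((Int.ofNat (0 + 1) : ℤ) : ℝ) = a + 1 + 1 by push_cast; simp; ring]
    exact sub_one_mul_pow_le_right hK ha le_rfl hx.2
  -- `(2m+3)² ≥ 4(m+1)(m+2)` makes the squared weight summable by telescoping.
  · refine ⟨1 / (4 * (2 * (m : ℝ) + 3)), by positivity, ?_, ?_⟩
    · simp only [coeffBound]
      rw [div_pow, one_pow, one_div_mul_one_div]
      apply one_div_le_one_div_of_le (by positivity)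
      nlinarith
    · rw [show a + 2 * ((Int.ofNat (m + 1 + 1) : ℤ) : ℝ) = a + 1 + (2 * (m : ℝ) + 3) by
        push_cast [Int.ofNat_eq_natCast]; ring]
      exact sub_one_mul_pow_le_right hK ha (by linarith [Nat.cast_nonneg (α := ℝ) m]) hx.2
  · refine ⟨1 / (2 * 1), by norm_num, by norm_num [coeffBound], ?_⟩
    rw [show a + 2 * ((Int.negSucc 0 : ℤ) : ℝ) = a - 1 - 1 by norm_num; ring]
    exact sub_one_mul_pow_le_left hK ha le_rfl hx.1 (by linarith)
  · refine ⟨1 / 6, by norm_num, by norm_num [coeffBound], ?_⟩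
    rw [show a + 2 * ((Int.negSucc (0 + 1) : ℤ) : ℝ) = a - 1 - 3 by
      push_cast [Int.negSucc_eq]; ring]
    exact sub_one_mul_pow_le_three hr hK ha hx.1
  · have hm := Nat.cast_nonneg (α := ℝ) m
    refine ⟨1 / (2 * (m : ℝ) + 5), by positivity, ?_, ?_⟩
    · simp only [coeffBound]
      rw [div_pow, one_pow, one_div_mul_one_div]
      apply one_div_le_one_div_of_le (by positivity)
      nlinarith
    · rw [show a + 2 * ((Int.negSucc (m + 1 + 1) : ℤ) : ℝ) = a - 1 - (2 * (m : ℝ) + 5) by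
        push_cast [Int.negSucc_eq]; ring]
      rcases le_total 0 (a - 1 - (2 * (m : ℝ) + 5)) with hb | hb
      · refine (sub_one_mul_pow_le_left hK ha (by linarith) hx.1 hb).trans ?_
        gcongr
        linarith
      · exact sub_one_mul_pow_le_neg hr hK ha hx.1 hb

/-- `exists_coeff_le` for both signs of the centre `a` of the strip. -/
theorem exists_coeff_le_abs {r : ℕ} (hr : Odd r) {K a x : ℝ} (hK : 2 ≤ K)
    (ha : 2 * K - 1 ≤ |a|) (hx : x ∈ Icc ((a - 1) ^ (r + 2)) ((a + 1) ^ (r + 2)))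
    {j : ℤ} (hj : j ≠ 0) :
    ∃ w : ℝ, 0 ≤ w ∧ w ^ 2 ≤ coeffBound (if 0 ≤ a then j else -j) ∧
      (K - 1) * max 1 |a + 2 * j| ^ r ≤ w * |x - (a + 2 * j) ^ (r + 2)| := by
  split_ifs with h0
  · rw [abs_of_nonneg h0] at ha
    exact exists_coeff_le hr hK ha hx hj
  · rw [abs_of_neg (not_le.1 h0)] at ha
    -- The reflection `(a, x, j) ↦ (-a, -x, -j)` preserves the estimate since `n` is odd.
    have hodd : Odd (r + 2) := hr.add_even even_two
    have hx' : -x ∈ Icc ((-a - 1) ^ (r + 2)) ((-a + 1) ^ (r + 2)) := by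
      rw [show -a - 1 = -(a + 1) by ring, show -a + 1 = -(a - 1) by ring, hodd.neg_pow,
        hodd.neg_pow]
      exact ⟨neg_le_neg hx.2, neg_le_neg hx.1⟩
    obtain ⟨w, h1, h2, h3⟩ := exists_coeff_le hr hK ha hx' (neg_ne_zero.2 hj)
    refine ⟨w, h1, h2, ?_⟩
    rwa [show -a + 2 * ((-j : ℤ) : ℝ) = -(a + 2 * j) by push_cast; ring, abs_neg, hodd.neg_pow,
      show -x - -(a + 2 * (j : ℝ)) ^ (r + 2) = -(x - (a + 2 * (j : ℝ)) ^ (r + 2)) by ring,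
      abs_neg] at h3

/-- The radius of the disk about `aⁿ` is smaller than its distance to the ends of the strip. -/
theorem radius_lt_gap {r : ℕ} (hr : Odd r) {K a : ℝ} (hK : 2 ≤ K) (ha : 2 * K - 1 ≤ |a|) :
    3 / 2 * (K - 1) * |a| ^ r < a ^ (r + 2) - (a - 1) ^ (r + 2) ∧
      3 / 2 * (K - 1) * |a| ^ r < (a + 1) ^ (r + 2) - a ^ (r + 2) := by
  have key : ∀ b : ℝ, 2 * K - 1 ≤ b →
      3 / 2 * (K - 1) * b ^ r < b ^ (r + 2) - (b - 1) ^ (r + 2) ∧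
      3 / 2 * (K - 1) * b ^ r < (b + 1) ^ (r + 2) - b ^ (r + 2) := by
    intro b hb
    have hp : 0 < b ^ r := pow_pos (by linarith) r
    have h1 := sq_sub_sq_mul_pow_le (b := b) (c := b - 1) (by linarith) (by linarith) r
    have h2 := sq_sub_sq_mul_pow_le (b := b + 1) (c := b) (by linarith) (by linarith) r
    have h3 : b ^ r ≤ (b + 1) ^ r := pow_le_pow_left₀ (by linarith) (by linarith) r
    constructor
    · refine lt_of_lt_of_le (mul_lt_mul_of_pos_right ?_ hp) h1
      linarith
    · refine lt_of_lt_of_le ?_ h2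
      refine lt_of_lt_of_le (mul_lt_mul_of_pos_right ?_ hp)
        (mul_le_mul_of_nonneg_left h3 (by linarith))
      linarith
  rcases abs_cases a with ⟨h, _⟩ | ⟨h, _⟩
  · rw [h] at ha ⊢
    exact key a ha
  · rw [h] at ha ⊢
    have hodd : Odd (r + 2) := hr.add_even even_two
    have := key (-a) ha
    rw [show -a - 1 = -(a + 1) by ring, show -a + 1 = -(a - 1) by ring, hodd.neg_pow,
      hodd.neg_pow, hodd.neg_pow] at this
    constructor <;> linarith [this.1, this.2]

/-! ### Localization of the eigenvalues in the disks. -/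

theorem le_abs_two_mul_add {t : ℝ} (ht : t ∈ Ioc (-1 : ℝ) 1) (k : ℤ) :
    2 * (|k| : ℤ) - 1 ≤ |2 * (k : ℝ) + t| := by
  have h := abs_sub_abs_le_abs_add (2 * (k : ℝ)) t
  rw [abs_mul, abs_two] at h
  have h2 : |t| ≤ 1 := abs_le.2 ⟨ht.1.le, ht.2⟩
  push_cast
  linarith

theorem constC_le {n : ℕ} {p : ℕ → ℝ → ℂ} {N k : ℤ}
    (hN : Real.pi⁻¹ ^ 2 * constC n p + 1 ≤ (N : ℝ)) (hk : N ≤ |k|) :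
    constC n p ≤ Real.pi ^ 2 * ((|k| : ℤ) - 1) := by
  have h : (N : ℝ) ≤ (|k| : ℤ) := by exact_mod_cast hk
  have h2 : Real.pi⁻¹ ^ 2 * constC n p ≤ (|k| : ℤ) - 1 := by linarith
  rwa [inv_pow, inv_mul_le_iff₀ (by positivity)] at h2

/-- Positivity of `C` makes `N > 1`, and integrality then gives 2. -/
theorem two_le_abs {n : ℕ} {p : ℕ → ℝ → ℂ} {N k : ℤ} (hC : 0 < constC n p)
    (hN : Real.pi⁻¹ ^ 2 * constC n p + 1 ≤ (N : ℝ)) (hk : N ≤ |k|) :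
    (2 : ℝ) ≤ (|k| : ℤ) := by
  have h : (1 : ℝ) < N := by
    have := Real.pi_pos
    have : 0 < Real.pi⁻¹ ^ 2 * constC n p := by positivity
    linarith
  have h1 : (1 : ℤ) < N := by exact_mod_cast h
  have h2 : (2 : ℤ) ≤ |k| := by omega
  exact_mod_cast h2

theorem hasSum_sub_or_neg_sub {f : ℤ → ℝ} {T : ℝ} (h : HasSum f T) (P : Prop) [Decidable P]
    (k : ℤ) : HasSum (fun m : ℤ => f (if P then m - k else -(m - k))) T := by
  split_ifs
  · exact (Equiv.subRight k).hasSum_iff.2 h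
  · simp only [neg_sub]
    exact (Equiv.subLeft k).hasSum_iff.2 h

theorem mem_diskU_of_isEigenvalue {r : ℕ} (hr : Odd r) {p : ℕ → ℝ → ℂ} (hp : IsCoeff (r + 2) p)
    {t : ℝ} (ht : t ∈ Ioc (-1 : ℝ) 1) {N k : ℤ}
    (hN : Real.pi⁻¹ ^ 2 * constC (r + 2) p + 1 ≤ (N : ℝ)) (hC : 0 < constC (r + 2) p)
    (hk : N ≤ |k|) {ε : ℝ} (hε : ε ∈ Icc (0 : ℝ) 1) {lam : ℂ}
    (hlam : IsEigenvalue (r + 2) p t ε lam) (hstrip : lam ∈ stripP (r + 2) k t) :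
    lam ∈ diskU (r + 2) p k t := by
  by_contra hnot
  obtain ⟨y, -, hy, hy0, heq⟩ := hlam
  have hmem : MemLp y 2 unitMeasure := by
    have := (hy.absCont 0 (by omega)).continuousOn
    rw [uIcc_of_le zero_le_one, D_zero] at this
    exact memLp_of_continuousOn this
  have hpos := l2norm_pos hmem hy0
  have hπ := Real.pi_pos
  have hK := two_le_abs hC hN hk
  have hCK := constC_le hN hk
  have ha := le_abs_two_mul_add ht k
  set C := constC (r + 2) p with hCdef
  set K : ℝ := ((|k| : ℤ) : ℝ) with hKdef
  set a : ℝ := 2 * (k : ℝ) + t with hadef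
  set x : ℝ := lam.re / Real.pi ^ (r + 2) with hxdef
  have hx : x ∈ Icc ((a - 1) ^ (r + 2)) ((a + 1) ^ (r + 2)) := by
    obtain ⟨h1, h2⟩ := hstrip
    rw [show 2 * Real.pi * k + Real.pi * t - Real.pi = Real.pi * (a - 1) by rw [hadef]; ring,
      mul_pow] at h1
    rw [show 2 * Real.pi * k + Real.pi * t + Real.pi = Real.pi * (a + 1) by rw [hadef]; ring,
      mul_pow] at h2
    refine ⟨(le_div_iff₀' (by positivity)).2 h1, (div_le_iff₀' (by positivity)).2 h2.le⟩
  -- The centres are real, so distances to them are at least the distances of real parts.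
  have hdist : ∀ b : ℝ, Real.pi ^ (r + 2) * |x - b ^ (r + 2)| ≤
      ‖lam - ((Real.pi * b : ℝ) : ℂ) ^ (r + 2)‖ := by
    intro b
    refine le_trans (le_of_eq ?_) (Complex.abs_re_le_norm _)
    rw [← Complex.ofReal_pow, Complex.sub_re, Complex.ofReal_re, mul_pow, hxdef,
      ← abs_of_pos (pow_pos hπ (r + 2)), ← abs_mul, abs_of_pos (pow_pos hπ (r + 2)), mul_sub,
      mul_div_cancel₀ _ (pow_pos hπ (r + 2)).ne']
  have hcoef : ∀ m : ℤ, ‖∫ x in (0 : ℝ)..1, y x * wave (Real.pi * (2 * m + t)) x‖ ^ 2 ≤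
      coeffBound (if 0 ≤ a then m - k else -(m - k)) * l2norm y ^ 2 := by
    intro m
    have hest := norm_sub_mul_norm_integral_le hp (by omega) hε hy heq m
    set Y := ‖∫ x in (0 : ℝ)..1, y x * wave (Real.pi * (2 * m + t)) x‖
    have hY : 0 ≤ Y := norm_nonneg _
    rw [Nat.add_sub_cancel, ← hCdef] at hest
    suffices h : ∃ w : ℝ, 0 ≤ w ∧ w ^ 2 ≤ coeffBound (if 0 ≤ a then m - k else -(m - k)) ∧
        Y ≤ w * l2norm y by
      obtain ⟨w, -, hw1, hw2⟩ := h
      calc Y ^ 2 ≤ (w * l2norm y) ^ 2 := pow_le_pow_left₀ hY hw2 2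
        _ = w ^ 2 * l2norm y ^ 2 := by ring
        _ ≤ _ := by gcongr
    rcases eq_or_ne m k with rfl | hmk
    -- For `m = k` the weight is the reciprocal of the factor 3/2 in the radius. Here `|a| ≥ 3`, so
    -- the maximum with 1 disappears.
    · refine ⟨2 / 3, by norm_num, ?_, ?_⟩
      · rw [sub_self, neg_zero, ite_self]
        norm_num [coeffBound]
      · rw [← hadef, max_eq_right (by linarith)] at hest
        have hR : 0 < Real.pi ^ r * C * |a| ^ r :=
          mul_pos (mul_pos (by positivity) hC) (pow_pos (by linarith) r)
        have hfar : 3 / 2 * (Real.pi ^ r * C * |a| ^ r) ≤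
            ‖lam - ((Real.pi * a : ℝ) : ℂ) ^ (r + 2)‖ := by
          rw [diskU, Metric.mem_ball, not_lt, Complex.dist_eq, Nat.add_sub_cancel, ← hCdef,
            ← hadef, show 2 * Real.pi * m + Real.pi * t = Real.pi * a by rw [hadef]; ring,
            Complex.ofReal_pow] at hnot
          linarith
        have := (mul_le_mul_of_nonneg_right hfar hY).trans hest
        have h2 : (Real.pi ^ r * C * |a| ^ r) * (3 / 2 * Y) ≤
            (Real.pi ^ r * C * |a| ^ r) * l2norm y := by linarith
        have := le_of_mul_le_mul_left h2 hR
        linarith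
    · obtain ⟨w, hw0, hw1, hw2⟩ := exists_coeff_le_abs hr hK ha hx (sub_ne_zero.2 hmk)
      refine ⟨w, hw0, hw1, ?_⟩
      rw [show a + 2 * ((m - k : ℤ) : ℝ) = 2 * (m : ℝ) + t by rw [hadef]; push_cast; ring] at hw2
      set b : ℝ := 2 * (m : ℝ) + t
      have hM : 0 < max 1 |b| ^ r := pow_pos (lt_max_of_lt_left one_pos) r
      have hKM : 0 < (K - 1) * max 1 |b| ^ r := mul_pos (by linarith) hM
      -- `hw2` bounds a positive quantity by `w` times this distance, so the distance can be
      -- cancelled below.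
      have hδ : 0 < |x - b ^ (r + 2)| := by
        by_contra h
        have := le_antisymm (not_lt.1 h) (abs_nonneg _)
        rw [this, mul_zero] at hw2
        linarith
      have h1 : Real.pi ^ (r + 2) * (|x - b ^ (r + 2)| * Y) ≤
          Real.pi ^ (r + 2) * (|x - b ^ (r + 2)| * (w * l2norm y)) := by
        calc Real.pi ^ (r + 2) * (|x - b ^ (r + 2)| * Y)
            = Real.pi ^ (r + 2) * |x - b ^ (r + 2)| * Y := by ring
          _ ≤ ‖lam - ((Real.pi * b : ℝ) : ℂ) ^ (r + 2)‖ * Y :=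
              mul_le_mul_of_nonneg_right (hdist b) hY
          _ ≤ Real.pi ^ r * C * max 1 |b| ^ r * l2norm y := hest
          _ ≤ Real.pi ^ r * (Real.pi ^ 2 * (K - 1)) * max 1 |b| ^ r * l2norm y := by gcongr
          _ = Real.pi ^ (r + 2) * ((K - 1) * max 1 |b| ^ r * l2norm y) := by ring
          _ ≤ Real.pi ^ (r + 2) * (w * |x - b ^ (r + 2)| * l2norm y) := by gcongr
          _ = _ := by ring
      exact le_of_mul_le_mul_left (le_of_mul_le_mul_left h1 (by positivity)) hδ
  obtain ⟨T, hT1, hT⟩ := exists_hasSum_coeffBound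
  have hT' := hasSum_sub_or_neg_sub hT (0 ≤ a) k
  have := hasSum_le hcoef (hasSum_sq_integral_wave hmem t) (hT'.mul_right (l2norm y ^ 2))
  -- Parseval would give `‖y‖² ≤ T ‖y‖²` with `T < 1` and `‖y‖ > 0`.
  nlinarith [pow_pos hpos 2]

/-! ### Disjointness of the closures, by projection to the real axis. -/

/-- The closure of the disk `U(k,t)` lies over the interior of the interval `I(k,t)`. -/
theorem re_mem_of_mem_closure_diskU {r : ℕ} (hr : Odd r) {p : ℕ → ℝ → ℂ}
    {t : ℝ} (ht : t ∈ Ioc (-1 : ℝ) 1) {N k : ℤ}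
    (hN : Real.pi⁻¹ ^ 2 * constC (r + 2) p + 1 ≤ (N : ℝ)) (hk : N ≤ |k|) {z : ℂ}
    (hz : z ∈ closure (diskU (r + 2) p k t)) :
    (2 * Real.pi * k + Real.pi * t - Real.pi) ^ (r + 2) < z.re ∧
      z.re < (2 * Real.pi * k + Real.pi * t + Real.pi) ^ (r + 2) := by
  rcases (constC_nonneg (r + 2) p).eq_or_lt with h0 | hC
  -- For `C = 0` the open ball of radius 0 is empty, and so is its closure.
  · rw [diskU, ← h0] at hz
    simp at hz
  have hπ := Real.pi_pos
  have hK := two_le_abs hC hN hk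
  have hCK := constC_le hN hk
  have ha := le_abs_two_mul_add ht k
  have hball := Metric.closure_ball_subset_closedBall hz
  rw [Metric.mem_closedBall, Complex.dist_eq, Nat.add_sub_cancel] at hball
  have hre := (Complex.abs_re_le_norm _).trans hball
  rw [Complex.sub_re, Complex.ofReal_re] at hre
  obtain ⟨g1, g2⟩ := radius_lt_gap hr hK ha
  set C := constC (r + 2) p with hCdef
  set K : ℝ := ((|k| : ℤ) : ℝ) with hKdef
  set a : ℝ := 2 * (k : ℝ) + t with hadef
  rw [show 2 * Real.pi * k + Real.pi * t = Real.pi * a by rw [hadef]; ring] at hre ⊢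
  rw [show Real.pi * a - Real.pi = Real.pi * (a - 1) by ring,
    show Real.pi * a + Real.pi = Real.pi * (a + 1) by ring]
  have hR : 3 / 2 * Real.pi ^ r * C * |a| ^ r ≤
      Real.pi ^ (r + 2) * (3 / 2 * (K - 1) * |a| ^ r) := by
    calc 3 / 2 * Real.pi ^ r * C * |a| ^ r ≤
          3 / 2 * Real.pi ^ r * (Real.pi ^ 2 * (K - 1)) * |a| ^ r := by gcongr
      _ = _ := by ring
  have hpn : 0 < Real.pi ^ (r + 2) := by positivity
  have k1 := mul_lt_mul_of_pos_left g1 hpn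
  have k2 := mul_lt_mul_of_pos_left g2 hpn
  rw [mul_pow] at hre
  rw [mul_pow, mul_pow]
  rw [abs_le] at hre
  constructor <;> linarith [hre.1, hre.2]

theorem re_mem_of_mem_closure_stripS {n : ℕ} {N : ℤ} {t : ℝ} {z : ℂ}
    (hz : z ∈ closure (stripS n N t)) :
    (-2 * Real.pi * N + Real.pi + Real.pi * t) ^ n ≤ z.re ∧
      z.re ≤ (2 * Real.pi * N - Real.pi + Real.pi * t) ^ n := by
  have hcl : IsClosed {z : ℂ | z.re ∈ Icc ((-2 * Real.pi * N + Real.pi + Real.pi * t) ^ n)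
      ((2 * Real.pi * N - Real.pi + Real.pi * t) ^ n)} :=
    isClosed_Icc.preimage Complex.continuous_re
  have hsub : stripS n N t ⊆ {z : ℂ | z.re ∈ Icc ((-2 * Real.pi * N + Real.pi + Real.pi * t) ^ n)
      ((2 * Real.pi * N - Real.pi + Real.pi * t) ^ n)} := fun w hw => Ico_subset_Icc_self hw
  exact closure_minimal hsub hcl hz

theorem disjoint_closure_stripS_diskU {r : ℕ} (hr : Odd r) {p : ℕ → ℝ → ℂ}
    {t : ℝ} (ht : t ∈ Ioc (-1 : ℝ) 1) {N k : ℤ}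
    (hN : Real.pi⁻¹ ^ 2 * constC (r + 2) p + 1 ≤ (N : ℝ)) (hk : N ≤ |k|) :
    Disjoint (closure (stripS (r + 2) N t)) (closure (diskU (r + 2) p k t)) := by
  rw [Set.disjoint_left]
  intro z hS hU
  obtain ⟨s1, s2⟩ := re_mem_of_mem_closure_stripS hS
  obtain ⟨u1, u2⟩ := re_mem_of_mem_closure_diskU hr ht hN hk hU
  have hmono : StrictMono fun x : ℝ => x ^ (r + 2) := (hr.add_even even_two).strictMono_pow
  -- A common point would force `-N < k < N`.
  have h1 := hmono.lt_iff_lt.1 (u1.trans_le s2)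
  have h2 := hmono.lt_iff_lt.1 (s1.trans_lt u2)
  have h3 : (k : ℝ) < N := by
    have : Real.pi * k < Real.pi * N := by linarith
    exact lt_of_mul_lt_mul_left this Real.pi_pos.le
  have h4 : -(N : ℝ) < k := by
    have : Real.pi * -N < Real.pi * k := by linarith
    exact lt_of_mul_lt_mul_left this Real.pi_pos.le
  have h5 : |k| < N := abs_lt.2 ⟨by exact_mod_cast h4, by exact_mod_cast h3⟩
  omega

theorem disjoint_closure_diskU {r : ℕ} (hr : Odd r) {p : ℕ → ℝ → ℂ}
    {t : ℝ} (ht : t ∈ Ioc (-1 : ℝ) 1) {N k j : ℤ}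
    (hN : Real.pi⁻¹ ^ 2 * constC (r + 2) p + 1 ≤ (N : ℝ)) (hk : N ≤ |k|) (hj : N ≤ |j|)
    (hkj : k < j) :
    Disjoint (closure (diskU (r + 2) p k t)) (closure (diskU (r + 2) p j t)) := by
  rw [Set.disjoint_left]
  intro z hU hV
  have u := (re_mem_of_mem_closure_diskU hr ht hN hk hU).2
  have v := (re_mem_of_mem_closure_diskU hr ht hN hj hV).1
  have hmono : StrictMono fun x : ℝ => x ^ (r + 2) := (hr.add_even even_two).strictMono_pow
  have h1 := hmono.lt_iff_lt.1 (v.trans u)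
  have h2 : (k : ℝ) + 1 ≤ j := by exact_mod_cast hkj
  have := mul_le_mul_of_nonneg_left h2 Real.pi_pos.le
  linarith

end OddBloch

end

theorem theorem1 (n : ℕ) (hn : 1 < n) (hodd : Odd n) (p : ℕ → ℝ → ℂ)
    (hp : OddBloch.IsCoeff n p) (t : ℝ) (ht : t ∈ Set.Ioc (-1 : ℝ) 1)
    (N : ℤ) (hN : IsLeast {m : ℤ | Real.pi⁻¹ ^ 2 * OddBloch.constC n p + 1 ≤ (m : ℝ)} N) :
    (0 < OddBloch.constC n p →
      ∀ k : ℤ, N ≤ |k| → ∀ ε ∈ Set.Icc (0 : ℝ) 1, ∀ lam : ℂ,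
        OddBloch.IsEigenvalue n p t ε lam → lam ∈ OddBloch.stripP n k t →
          lam ∈ OddBloch.diskU n p k t) ∧
    (∀ k : ℤ, N ≤ |k| →
      Disjoint (closure (OddBloch.stripS n N t)) (closure (OddBloch.diskU n p k t))) ∧
    (∀ k j : ℤ, N ≤ |k| → N ≤ |j| → k ≠ j →
      Disjoint (closure (OddBloch.diskU n p k t)) (closure (OddBloch.diskU n p j t))) := by
  obtain ⟨r, rfl⟩ : ∃ r, n = r + 2 := ⟨n - 2, by omega⟩
  have hr : Odd r := (Nat.odd_add.1 hodd).2 even_two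
  refine ⟨fun hC k hk ε hε lam hlam hs =>
    OddBloch.mem_diskU_of_isEigenvalue hr hp ht hN.1 hC hk hε hlam hs,
    fun k hk => OddBloch.disjoint_closure_stripS_diskU hr ht hN.1 hk, fun k j hk hj hkj => ?_⟩
  rcases lt_or_gt_of_ne hkj with h | h
  · exact OddBloch.disjoint_closure_diskU hr ht hN.1 hk hj h
  · exact (OddBloch.disjoint_closure_diskU hr ht hN.1 hj hk h).symm
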